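/- Let $N=\mathbb Z^2\subset N_{\mathbb R}=\mathbb R^2$, and identify the dual lattice $M=\operatorname{Hom}(N,\mathbb Z)$ with $\mathbb Z^2$ through the standard pairing $\langle\cdot,\cdot\rangle$. A lattice polygon is the convex hull in $\mathbb R^2$ of finitely many points of $\mathbb Z^2$. A lattice polygon $\nabla$ with the origin in its interior is called reflexive if its polar dual $\nabla^*=\{u\in\mathbb R^2 : \langle u,v\rangle\ge -1 \text{ for all } v\in\nabla\}$ is also a lattice polygon, and terminal if $\nabla\cap\mathbb Z^2$ consists exactly of the vertices of $\nabla$ and the origin. The reflexive polygons form a single connected web under inclusion, without identifying unimodularly equivalent polygons: for any two reflexive polygons $\nabla,\nabla'\subset\mathbb R^2$ there is a finite sequence $\nabla=\nabla_0,\nabla_1,\dots,\nabla_n=\nabla'$ of reflexive polygons in $\mathbb R^2$ such that, for each $0\le i<n$, $\nabla_i\subset\nabla_{i+1}$ or $\nabla_i\supset\nabla_{i+1}$. In the same way, any two terminal polygons are joined by a finite sequence of terminal polygons in which consecutive members are comparable under inclusion. Moreover, both classes are non-empty. -/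

import Mathlib

namespace LatticeWeb

/-- The lattice `ℤ^d`, as a subset of `ℝ^d`.  Through the dot product it serves both as the lattice `N`
and as its dual lattice `M = Hom(N, ℤ)`. -/
def lattice (d : ℕ) : Set (Fin d → ℝ) :=
  Set.range (fun (v : Fin d → ℤ) (i : Fin d) => (v i : ℝ))

/-- A lattice polytope: the convex hull of finitely many lattice points. -/
def IsLatticePolytope {d : ℕ} (P : Set (Fin d → ℝ)) : Prop :=
  ∃ S : Finset (Fin d → ℝ), (S : Set (Fin d → ℝ)) ⊆ lattice d ∧
    P = convexHull ℝ (S : Set (Fin d → ℝ))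

/-- The polar dual `{u | ⟨u, v⟩ ≥ -1 for all v ∈ P}`. -/
def polarDual {d : ℕ} (P : Set (Fin d → ℝ)) : Set (Fin d → ℝ) :=
  {u | ∀ v ∈ P, -1 ≤ u ⬝ᵥ v}

/-- A reflexive polytope: a lattice polytope with the origin in its interior whose polar dual is
again a lattice polytope. -/
def IsReflexive {d : ℕ} (P : Set (Fin d → ℝ)) : Prop :=
  IsLatticePolytope P ∧ (0 : Fin d → ℝ) ∈ interior P ∧ IsLatticePolytope (polarDual P)

/-- A terminal polytope: a lattice polytope with the origin in its interior whose lattice points are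
exactly its vertices and the origin. -/
def IsTerminal {d : ℕ} (P : Set (Fin d → ℝ)) : Prop :=
  IsLatticePolytope P ∧ (0 : Fin d → ℝ) ∈ interior P ∧
    P ∩ lattice d = P.extremePoints ℝ ∪ {0}

/-- The web of a class `C` of polytopes: the graph whose vertices are the members of `C` (as subsets
of `ℝ^d`, with no identification), two distinct members being adjacent when one contains the other. -/
def inclusionWeb {d : ℕ} (C : Set (Fin d → ℝ) → Prop) :
    SimpleGraph {P : Set (Fin d → ℝ) // C P} :=
  SimpleGraph.fromRel (fun P Q => P.1 ⊆ Q.1)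

end LatticeWeb

namespace LatticeWeb

/-! Reflexive and terminal polygons share one property, `IsCanonical`: stretching a nonzero lattice
point by a factor above 1 leaves the polygon, so the origin is the only interior lattice point. For
reflexive polygons this is integrality of the dual (`IsReflexive.isCanonical`); for terminal ones, a
lattice point strictly between the origin and another point of the polygon cannot be a vertex
(`IsTerminal.isCanonical`).

A canonical polygon contains an `SL(2, ℤ)`-copy of one of three minimal polygons: the triangle of
`ℙ²`, the diamond of `ℙ¹ × ℙ¹` or the triangle of `ℙ(1,1,2)` (`IsCanonical.containsMinimal`,
`exists_slMap_image_subset`). The argument takes lattice points of the polygon at height ±1 on the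
two sides of a lattice vector `b`. Their sum is a multiple `s • b`, and their midpoint forces `|s| ≤
2`, which leaves five cases.

It remains to connect the copies of the minimal polygons. The first two models lie in the hexagon.
All copies of the hexagon are joined because the generators `S` and `T` of `SL(2, ℤ)` each move the
diamond into the hexagon (`webJoined_hexagon`). The third model is joined to the diamond through the
square in the reflexive case, and cannot occur inside a terminal polygon because one of its edges
has a lattice midpoint. -/

theorem neg_mem_lattice {d : ℕ} {x : Fin d → ℝ} (hx : x ∈ lattice d) : -x ∈ lattice d := by
  obtain ⟨v, rfl⟩ := hx
  exact ⟨-v, by ext i; simp⟩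

theorem add_mem_lattice {d : ℕ} {x y : Fin d → ℝ} (hx : x ∈ lattice d) (hy : y ∈ lattice d) :
    x + y ∈ lattice d := by
  obtain ⟨v, rfl⟩ := hx
  obtain ⟨w, rfl⟩ := hy
  exact ⟨v + w, by ext i; simp⟩

theorem zsmul_mem_lattice {d : ℕ} (n : ℤ) {x : Fin d → ℝ} (hx : x ∈ lattice d) :
    (n : ℝ) • x ∈ lattice d := by
  obtain ⟨v, rfl⟩ := hx
  exact ⟨n • v, by ext i; simp⟩

/-! ### Canonical polytopes and convexity preliminaries -/

/-- The determinant of the pair `(x, y)` of plane vectors. -/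
def planeDet (x y : Fin 2 → ℝ) : ℝ := x 0 * y 1 - x 1 * y 0

/-- A lattice polytope around the origin in which every nonzero lattice point lies on the
boundary. -/
structure IsCanonical {d : ℕ} (P : Set (Fin d → ℝ)) : Prop where
  isLatticePolytope : IsLatticePolytope P
  zero_mem_interior : (0 : Fin d → ℝ) ∈ interior P
  smul_notMem : ∀ x ∈ lattice d, x ≠ 0 → ∀ t : ℝ, 1 < t → t • x ∉ P

theorem IsLatticePolytope.convex {d : ℕ} {P : Set (Fin d → ℝ)} (h : IsLatticePolytope P) :
    Convex ℝ P := by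
  obtain ⟨S, -, rfl⟩ := h
  exact convex_convexHull ℝ _

theorem IsLatticePolytope.isCompact {d : ℕ} {P : Set (Fin d → ℝ)} (h : IsLatticePolytope P) :
    IsCompact P := by
  obtain ⟨S, -, rfl⟩ := h
  exact S.finite_toSet.isCompact_convexHull (𝕜 := ℝ)

theorem IsLatticePolytope.extremePoints_subset {d : ℕ} {P : Set (Fin d → ℝ)}
    (h : IsLatticePolytope P) : P.extremePoints ℝ ⊆ lattice d := by
  obtain ⟨S, hS, rfl⟩ := h
  exact extremePoints_convexHull_subset.trans hS

/-- A convex set around the origin contains small multiples of every vector. -/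
theorem exists_pos_smul_mem {d : ℕ} {P : Set (Fin d → ℝ)} (h : (0 : Fin d → ℝ) ∈ interior P)
    (x : Fin d → ℝ) : ∃ t : ℝ, 0 < t ∧ t • x ∈ P := by
  have hc : Filter.Tendsto (fun t : ℝ => t • x) (nhdsWithin 0 (Set.Ioi 0)) (nhds 0) := by
    have : Continuous fun t : ℝ => t • x := by fun_prop
    simpa using (this.tendsto 0).mono_left nhdsWithin_le_nhds
  have h1 := hc.eventually (mem_interior_iff_mem_nhds.1 h)
  obtain ⟨t, ht, ht'⟩ := (h1.and self_mem_nhdsWithin).exists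
  exact ⟨t, ht', ht⟩

/-- A lattice polytope around the origin has a lattice point on the positive side of every
nonzero linear functional. -/
theorem IsLatticePolytope.exists_pos {d : ℕ} {P : Set (Fin d → ℝ)} (h : IsLatticePolytope P)
    (h0 : (0 : Fin d → ℝ) ∈ interior P) (f : (Fin d → ℝ) →ₗ[ℝ] ℝ) (x : Fin d → ℝ)
    (hx : 0 < f x) : ∃ z ∈ P, z ∈ lattice d ∧ 0 < f z := by
  obtain ⟨S, hS, rfl⟩ := h
  by_contra! hneg
  obtain ⟨t, ht, hm⟩ := exists_pos_smul_mem h0 x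
  have hsub : convexHull ℝ (S : Set (Fin d → ℝ)) ⊆ {z | f z ≤ 0} :=
    convexHull_min (fun z hz => hneg z (subset_convexHull ℝ _ hz) (hS hz))
      (convex_halfSpace_le f.isLinear 0)
  have := hsub hm
  simp only [Set.mem_ofPred_eq, map_smul, smul_eq_mul] at this
  nlinarith [mul_pos ht hx]

theorem Convex.smul_add_smul_mem {E : Type*} [AddCommGroup E] [Module ℝ E] {P : Set E}
    (hP : Convex ℝ P) (h0 : (0 : E) ∈ P) {x y : E} (hx : x ∈ P) (hy : y ∈ P) {s t : ℝ}
    (hs : 0 ≤ s) (ht : 0 ≤ t) (hst : s + t ≤ 1) : s • x + t • y ∈ P := by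
  rcases eq_or_lt_of_le (add_nonneg hs ht) with h | h
  · have hs' : s = 0 := by linarith
    have ht' : t = 0 := by linarith
    simpa [hs', ht'] using h0
  · have hz := hP hx hy (div_nonneg hs h.le) (div_nonneg ht h.le) (by field_simp)
    have := hP.smul_mem_of_zero_mem h0 hz ⟨h.le, hst⟩
    rwa [smul_add, smul_smul, smul_smul, mul_div_cancel₀ _ h.ne', mul_div_cancel₀ _ h.ne'] at this

/-! ### Lattice points of a canonical polygon at height ±1 -/

namespace IsCanonical

variable {P : Set (Fin 2 → ℝ)}

theorem zero_mem (hP : IsCanonical P) : (0 : Fin 2 → ℝ) ∈ P :=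
  interior_subset hP.zero_mem_interior

theorem smul_mem_le (hP : IsCanonical P) {x : Fin 2 → ℝ} (hx : x ∈ lattice 2) (hx0 : x ≠ 0)
    {s : ℤ} (h : ((s : ℝ) / 2) • x ∈ P) : s ≤ 2 ∧ -2 ≤ s := by
  constructor
  · by_contra! hs
    have hs' : (3 : ℝ) ≤ s := by exact_mod_cast hs
    exact hP.smul_notMem x hx hx0 (s / 2) (by linarith) h
  · by_contra! hs
    have hs' : (s : ℝ) ≤ -3 := by exact_mod_cast (by omega : s ≤ -3)
    refine hP.smul_notMem (-x) (neg_mem_lattice hx) (neg_ne_zero.2 hx0) (-s / 2) (by linarith) ?_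
    convert h using 1
    module

/-- The midpoint argument: if `x + y = s • b` with `x, y ∈ P`, then `|s| ≤ 2`. -/
theorem abs_le_two_of_add_eq (hP : IsCanonical P) {x y b : Fin 2 → ℝ} (hx : x ∈ P) (hy : y ∈ P)
    (hb : b ∈ lattice 2) (hb0 : b ≠ 0) {s : ℤ} (h : x + y = (s : ℝ) • b) : s ≤ 2 ∧ -2 ≤ s := by
  refine hP.smul_mem_le hb hb0 ?_
  have := hP.isLatticePolytope.convex hx hy (a := 1 / 2) (b := 1 / 2) (by norm_num) (by norm_num)
    (by norm_num)
  rw [← smul_add, h, smul_smul] at this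
  convert this using 2
  ring

/-- A nonprimitive `a` would be a multiple, by an integer above 1, of a nonzero lattice point, which
a canonical polygon excludes. So `a` is primitive and Bézout's identity applies. -/
theorem exists_bezout (hP : IsCanonical P) {a : Fin 2 → ℝ} (ha : a ∈ P) (hl : a ∈ lattice 2)
    (ha0 : a ≠ 0) : ∃ e ∈ lattice 2, planeDet a e = 1 := by
  obtain ⟨v, rfl⟩ := hl
  have hv : Int.gcd (v 0) (v 1) ≠ 0 := by
    intro h
    rw [Int.gcd_eq_zero_iff] at h
    apply ha0
    ext i
    fin_cases i <;> simp [h]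
  have hg : Int.gcd (v 0) (v 1) = 1 := by
    by_contra hne
    obtain ⟨p, hp⟩ := Int.gcd_dvd_left (v 0) (v 1)
    obtain ⟨q, hq⟩ := Int.gcd_dvd_right (v 0) (v 1)
    generalize Int.gcd (v 0) (v 1) = g at *
    have hp' : (v 0 : ℝ) = g * p := by exact_mod_cast hp
    have hq' : (v 1 : ℝ) = g * q := by exact_mod_cast hq
    have key : (fun i => (v i : ℝ)) = (g : ℝ) • ![(p : ℝ), q] := by
      ext i
      fin_cases i <;> simp [hp', hq']
    refine hP.smul_notMem ![(p : ℝ), q] ⟨![p, q], ?_⟩ ?_ (g : ℝ) ?_ (key ▸ ha)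
    · ext i
      fin_cases i <;> simp
    · intro h
      exact ha0 (key.trans (by rw [h, smul_zero]))
    · exact_mod_cast (by omega : 1 < g)
  refine ⟨fun i => ((![-Int.gcdB (v 0) (v 1), Int.gcdA (v 0) (v 1)] i : ℤ) : ℝ), ⟨_, rfl⟩, ?_⟩
  have h := Int.gcd_eq_gcd_ab (v 0) (v 1)
  rw [hg] at h
  have h' : (1 : ℝ) = v 0 * Int.gcdA (v 0) (v 1) + v 1 * Int.gcdB (v 0) (v 1) := by
    exact_mod_cast h
  simp only [planeDet, Matrix.cons_val_zero, Matrix.cons_val_one]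
  push_cast
  linarith

/-- Measure height by `ε * planeDet a ·`. Some lattice point `z` of `P` has positive height `q`. At
height 1 the triangle with vertices `0`, `a`, `z` contains a closed segment parallel to `a` of
length `(q - 1) / q` times that of `a`. Lattice points on that line are spaced by `a` with offset in
`(1 / q) ℤ`, so the segment meets one of them. -/
theorem exists_planeDet_eq (hP : IsCanonical P) {a : Fin 2 → ℝ} (ha : a ∈ P)
    (hl : a ∈ lattice 2) (ha0 : a ≠ 0) {ε : ℝ} (hε : ε = 1 ∨ ε = -1) :
    ∃ b ∈ P, b ∈ lattice 2 ∧ planeDet a b = ε := by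
  have hε2 : ε * ε = 1 := by rcases hε with rfl | rfl <;> norm_num
  have hεZ : ∃ k : ℤ, ε = k := by
    rcases hε with rfl | rfl
    · exact ⟨1, by simp⟩
    · exact ⟨-1, by simp⟩
  obtain ⟨k, hk⟩ := hεZ
  obtain ⟨e, hel, he⟩ := hP.exists_bezout ha hl ha0
  let f : (Fin 2 → ℝ) →ₗ[ℝ] ℝ :=
    { toFun := fun z => ε * planeDet a z
      map_add' := fun x y => by simp only [planeDet, Pi.add_apply]; ring
      map_smul' := fun c x => by
        simp only [planeDet, Pi.smul_apply, smul_eq_mul, RingHom.id_apply]; ring }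
  obtain ⟨z, hz, hzl, hzpos⟩ := hP.isLatticePolytope.exists_pos hP.zero_mem_interior f (ε • e)
    (by rw [map_smul]; change 0 < ε * (ε * planeDet a e); rw [he]; nlinarith)
  have hzpos : 0 < ε * planeDet a z := hzpos
  obtain ⟨w, rfl⟩ := hzl
  obtain ⟨v, rfl⟩ := hl
  obtain ⟨u, rfl⟩ := hel
  simp only [planeDet] at he hzpos ⊢
  subst hk
  set q : ℤ := k * (v 0 * w 1 - v 1 * w 0) with hq
  set p : ℤ := w 0 * u 1 - w 1 * u 0 with hp
  have hq1 : 1 ≤ q := by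
    have : (0 : ℝ) < q := by rw [hq]; push_cast; exact hzpos
    exact_mod_cast this
  have hq1' : (1 : ℝ) ≤ q := by exact_mod_cast hq1
  have hq0 : (0 : ℝ) < q := by linarith
  have hqR : (q : ℝ) = k * (v 0 * w 1 - v 1 * w 0) := by rw [hq]; push_cast; ring
  have hpR : (p : ℝ) = w 0 * u 1 - w 1 * u 0 := by rw [hp]; push_cast; ring
  -- In the basis `a`, `e` one has `z = p • a + (q * ε) • e`. With `m` the ceiling of `p / q`, the
  -- point built below is `m • a + ε • e`.
  obtain ⟨m, hm1, hm2⟩ : ∃ m : ℤ, p ≤ m * q ∧ m * q ≤ p + q - 1 := by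
    refine ⟨(p + q - 1) / q, ?_, Int.ediv_mul_le _ (by omega)⟩
    have := Int.lt_ediv_add_one_mul_self (p + q - 1) (by omega : 0 < q)
    nlinarith
  have hm1' : (p : ℝ) ≤ m * q := by exact_mod_cast hm1
  have hm2' : (m * q : ℝ) ≤ p + q - 1 := by exact_mod_cast hm2
  have hmem := Convex.smul_add_smul_mem hP.isLatticePolytope.convex hP.zero_mem hz ha
    (s := 1 / q) (t := (m * q - p) / q) (by positivity) (div_nonneg (by linarith) hq0.le)
    (by rw [← add_div, div_le_one hq0]; linarith)
  refine ⟨_, hmem, ?_, ?_⟩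
  · refine ⟨fun i => m * v i + k * u i, ?_⟩
    have h0 : (w 0 : ℝ) = p * v 0 + q * k * u 0 := by
      rw [hqR, hpR]
      linear_combination (-(w 0 : ℝ)) * he - (v 0 * w 1 - v 1 * w 0) * u 0 * hε2
    have h1 : (w 1 : ℝ) = p * v 1 + q * k * u 1 := by
      rw [hqR, hpR]
      linear_combination (-(w 1 : ℝ)) * he - (v 0 * w 1 - v 1 * w 0) * u 1 * hε2
    ext i
    fin_cases i
    · simp [h0]; field_simp; ring
    · simp [h1]; field_simp; ring
  · simp only [Pi.add_apply, Pi.smul_apply, smul_eq_mul]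
    field_simp
    rw [hqR]
    linear_combination (-(v 0 * w 1 - v 1 * w 0 : ℝ)) * hε2

end IsCanonical

/-- Cramer's rule in the unimodular basis `a`, `b`: the coordinate of `x` along `a` vanishes, and
the one along `b` is `planeDet a x` up to sign, hence an integer. -/
theorem exists_eq_smul_of_planeDet_eq_zero {a b x : Fin 2 → ℝ} (ha : a ∈ lattice 2)
    (hx : x ∈ lattice 2) (hab : planeDet a b = 1 ∨ planeDet a b = -1)
    (h : planeDet b x = 0) : ∃ s : ℤ, x = (s : ℝ) • b := by
  obtain ⟨v, rfl⟩ := ha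
  obtain ⟨w, rfl⟩ := hx
  simp only [planeDet] at h hab
  rcases hab with hab | hab
  · refine ⟨v 0 * w 1 - v 1 * w 0, ?_⟩
    ext i
    fin_cases i
    · simp; linear_combination (-(w 0 : ℝ)) * hab + (-(v 0 : ℝ)) * h
    · simp; linear_combination (-(w 1 : ℝ)) * hab + (-(v 1 : ℝ)) * h
  · refine ⟨-(v 0 * w 1 - v 1 * w 0), ?_⟩
    ext i
    fin_cases i
    · simp; linear_combination (w 0 : ℝ) * hab + (v 0 : ℝ) * h
    · simp; linear_combination (w 1 : ℝ) * hab + (v 1 : ℝ) * h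

/-! ### Existence of a minimal polygon inside a canonical one -/

/-- `P` contains the vertices of a unimodular copy of one of the three minimal reflexive polygons
(the Fano polygons of `ℙ²`, `ℙ¹ × ℙ¹` and `ℙ(1,1,2)`). -/
def ContainsMinimal (P : Set (Fin 2 → ℝ)) : Prop :=
  ∃ a ∈ P, ∃ b ∈ P, a ∈ lattice 2 ∧ b ∈ lattice 2 ∧ (planeDet a b = 1 ∨ planeDet a b = -1) ∧
    (-a - b ∈ P ∨ (-a ∈ P ∧ -b ∈ P) ∨ -a - (2 : ℝ) • b ∈ P)

theorem planeDet_comm (x y : Fin 2 → ℝ) : planeDet y x = -planeDet x y := by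
  simp only [planeDet]; ring

theorem planeDet_neg_right (x y : Fin 2 → ℝ) : planeDet x (-y) = -planeDet x y := by
  simp only [planeDet, Pi.neg_apply]; ring

theorem planeDet_add_right (x y z : Fin 2 → ℝ) :
    planeDet x (y + z) = planeDet x y + planeDet x z := by
  simp only [planeDet, Pi.add_apply]; ring

theorem planeDet_self (x : Fin 2 → ℝ) : planeDet x x = 0 := by
  simp only [planeDet]; ring

theorem ne_zero_of_planeDet {a b : Fin 2 → ℝ} (h : planeDet a b = 1 ∨ planeDet a b = -1) :
    a ≠ 0 ∧ b ≠ 0 := by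
  constructor <;> rintro rfl <;> simp [planeDet] at h

namespace IsCanonical

variable {P : Set (Fin 2 → ℝ)}

/-- Take lattice points `a`, `d` of `P` at height ±1 on the two sides of the line through `b`, so
that `a + d = s • b` with `|s| ≤ 2`. The values `0`, `±1`, `±2` of `s` give the diamond, the
triangle of `ℙ²` and that of `ℙ(1,1,2)`; the sign of `s` decides between using `b` and `-b`. -/
theorem containsMinimal_of_neg_mem (hP : IsCanonical P) {b : Fin 2 → ℝ} (hb : b ∈ P)
    (hbl : b ∈ lattice 2) (hb0 : b ≠ 0) (hnb : -b ∈ P) : ContainsMinimal P := by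
  obtain ⟨a, ha, hal, hba⟩ := hP.exists_planeDet_eq hb hbl hb0 (ε := -1) (by simp)
  obtain ⟨d, hd, hdl, hbd⟩ := hP.exists_planeDet_eq hb hbl hb0 (ε := 1) (by simp)
  have hab : planeDet a b = 1 := by rw [planeDet_comm, hba]; norm_num
  have hanb : planeDet a (-b) = -1 := by rw [planeDet_neg_right, hab]
  obtain ⟨s, hs⟩ := exists_eq_smul_of_planeDet_eq_zero hal (add_mem_lattice hal hdl)
    (Or.inl hab) (by rw [planeDet_add_right, hba, hbd]; norm_num)
  obtain ⟨h1, h2⟩ := hP.abs_le_two_of_add_eq ha hd hbl hb0 hs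
  have hd' : d = -a + (s : ℝ) • b := by rw [← hs]; abel
  interval_cases s
  · exact ⟨a, ha, b, hb, hal, hbl, Or.inl hab, Or.inr (Or.inr (by
      convert hd using 1; rw [hd']; push_cast; module))⟩
  · exact ⟨a, ha, b, hb, hal, hbl, Or.inl hab, Or.inl (by
      convert hd using 1; rw [hd']; push_cast; module)⟩
  · exact ⟨a, ha, b, hb, hal, hbl, Or.inl hab, Or.inr (Or.inl ⟨by
      convert hd using 1; rw [hd']; push_cast; module, hnb⟩)⟩
  · exact ⟨a, ha, -b, hnb, hal, neg_mem_lattice hbl, Or.inr hanb, Or.inl (by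
      convert hd using 1; rw [hd']; push_cast; module)⟩
  · exact ⟨a, ha, -b, hnb, hal, neg_mem_lattice hbl, Or.inr hanb, Or.inr (Or.inr (by
      convert hd using 1; rw [hd']; push_cast; module))⟩

/-- A lattice point `d` of `P` opposite to `a` across `b` satisfies `a + d = s • b` with `|s| ≤ 2`.
Value `-1` gives the triangle of `ℙ²`. Values `-2`, `0`, `1` put the antipode of `b`, `a`, `a - b`
respectively in `P`. Only `s = 2` escapes, and it is the second alternative. -/
theorem containsMinimal_or_mem (hP : IsCanonical P) {a b : Fin 2 → ℝ} (ha : a ∈ P)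
    (hal : a ∈ lattice 2) (hb : b ∈ P) (hbl : b ∈ lattice 2) (hc : a - b ∈ P)
    (hab : planeDet a b = 1 ∨ planeDet a b = -1) :
    ContainsMinimal P ∨ -a + (2 : ℝ) • b ∈ P := by
  obtain ⟨ha0, hb0⟩ := ne_zero_of_planeDet hab
  obtain ⟨d, hd, hdl, hbd⟩ := hP.exists_planeDet_eq hb hbl hb0 hab
  obtain ⟨s, hs⟩ := exists_eq_smul_of_planeDet_eq_zero hal (add_mem_lattice hal hdl)
    hab (by rw [planeDet_add_right, hbd, planeDet_comm a b]; ring)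
  obtain ⟨h1, h2⟩ := hP.abs_le_two_of_add_eq ha hd hbl hb0 hs
  have hd' : d = -a + (s : ℝ) • b := by rw [← hs]; abel
  have hcl : a - b ∈ lattice 2 := by
    rw [sub_eq_add_neg]; exact add_mem_lattice hal (neg_mem_lattice hbl)
  interval_cases s
  · refine Or.inl (hP.containsMinimal_of_neg_mem hb hbl hb0 ?_)
    have := hP.isLatticePolytope.convex ha hd (a := 1 / 2) (b := 1 / 2) (by norm_num)
      (by norm_num) (by norm_num)
    convert this using 1
    rw [hd']; push_cast; module
  · exact Or.inl ⟨a, ha, b, hb, hal, hbl, hab, Or.inl (by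
      convert hd using 1; rw [hd']; push_cast; module)⟩
  · refine Or.inl (hP.containsMinimal_of_neg_mem ha hal ha0 ?_)
    convert hd using 1
    rw [hd']; push_cast; module
  · refine Or.inl (hP.containsMinimal_of_neg_mem hc hcl ?_ ?_)
    · intro h
      have : a = b := sub_eq_zero.1 h
      rw [this, planeDet_self] at hab
      norm_num at hab
    · convert hd using 1
      rw [hd']; push_cast; module
  · right
    convert hd using 1
    rw [hd']; push_cast; module

/-- Every polygon with the origin as its only interior lattice point contains a unimodular copy of
one of the three minimal polygons. -/
theorem containsMinimal (hP : IsCanonical P) : ContainsMinimal P := by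
  have hconv := hP.isLatticePolytope.convex
  obtain ⟨a, hae⟩ := hP.isLatticePolytope.isCompact.extremePoints_nonempty ⟨0, hP.zero_mem⟩
  have hal := hP.isLatticePolytope.extremePoints_subset hae
  have ha := hae.1
  -- The origin, being interior, lies strictly between a positive and a negative multiple of `(1,
  -- 1)` in `P`, so it is not extreme.
  have ha0 : a ≠ 0 := by
    rintro rfl
    obtain ⟨t, ht, hm⟩ := exists_pos_smul_mem hP.zero_mem_interior (fun _ => (1 : ℝ))
    obtain ⟨t', ht', hm'⟩ := exists_pos_smul_mem hP.zero_mem_interior (fun _ => (-1 : ℝ))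
    have := hae.2 hm hm' ⟨t' / (t + t'), t / (t + t'), by positivity, by positivity,
      by field_simp; ring, by ext i; simp; field_simp; ring⟩
    have := congrFun this 0
    simp at this
    exact ht.ne' this
  obtain ⟨b, hb, hbl, hab⟩ := hP.exists_planeDet_eq ha hal ha0 (ε := 1) (by simp)
  obtain ⟨c, hc, hcl, hac⟩ := hP.exists_planeDet_eq ha hal ha0 (ε := -1) (by simp)
  have hba : planeDet b a = -1 := by rw [planeDet_comm, hab]
  obtain ⟨r, hr⟩ := exists_eq_smul_of_planeDet_eq_zero hbl (add_mem_lattice hbl hcl)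
    (Or.inr hba) (by rw [planeDet_add_right, hab, hac]; norm_num)
  obtain ⟨h1, h2⟩ := hP.abs_le_two_of_add_eq hb hc hal ha0 hr
  have hc' : c = (r : ℝ) • a - b := by rw [← hr]; abel
  have hb0 := (ne_zero_of_planeDet (Or.inl hab)).2
  interval_cases r
  · exact ⟨b, hb, a, ha, hbl, hal, Or.inr hba, Or.inr (Or.inr (by
      convert hc using 1; rw [hc']; push_cast; module))⟩
  · exact ⟨a, ha, b, hb, hal, hbl, Or.inl hab, Or.inl (by
      convert hc using 1; rw [hc']; push_cast; module)⟩
  · refine hP.containsMinimal_of_neg_mem hb hbl hb0 ?_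
    convert hc using 1
    rw [hc']; push_cast; module
  -- Here `a = b + c`. Applying `containsMinimal_or_mem` with `b` and then with `c` gives, unless it
  -- already finds a minimal polygon, both `-a + 2b = b - c` and `-a + 2c = c - b` in `P`, an
  -- antipodal pair.
  · have hcab : c = a - b := by rw [hc']; push_cast; module
    rcases hP.containsMinimal_or_mem ha hal hb hbl (hcab ▸ hc) (Or.inl hab) with h | h
    · exact h
    rcases hP.containsMinimal_or_mem ha hal hc hcl
      (by convert hb using 1; rw [hcab]; abel) (Or.inr hac) with h' | h'
    · exact h'
    refine hP.containsMinimal_of_neg_mem h ?_ ?_ ?_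
    · exact add_mem_lattice (neg_mem_lattice hal) (by exact_mod_cast zsmul_mem_lattice 2 hbl)
    · intro h0
      have h3 : planeDet (-a + (2 : ℝ) • b) b = -1 := by
        rw [planeDet_comm, planeDet_add_right, planeDet_neg_right, hba]
        simp [planeDet]; ring
      rw [h0] at h3
      simp [planeDet] at h3
    · convert h' using 1
      rw [hcab]; module
  -- Here `a` is the midpoint of `b` and `c`; this is the case that choosing `a` extreme rules out.
  · have hmid := hae.2 hb hc ⟨1 / 2, 1 / 2, by norm_num, by norm_num, by norm_num, by
      rw [hc']; push_cast; module⟩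
    rw [hmid, planeDet_self] at hab
    norm_num at hab

end IsCanonical


/-! ### Polar duality for finite sets of lattice points -/

theorem convex_polarDual {d : ℕ} (P : Set (Fin d → ℝ)) : Convex ℝ (polarDual P) := by
  intro x hx y hy s t hs ht hst v hv
  have h1 := hx v hv
  have h2 := hy v hv
  rw [add_dotProduct, smul_dotProduct, smul_dotProduct, smul_eq_mul, smul_eq_mul]
  nlinarith

theorem polarDual_convexHull {d : ℕ} (V : Set (Fin d → ℝ)) :
    polarDual (convexHull ℝ V) = polarDual V := by
  refine Set.Subset.antisymm (fun u hu v hv => hu v (subset_convexHull ℝ V hv)) ?_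
  intro u hu v hv
  have : convexHull ℝ V ⊆ polarDual {u} := by
    refine convexHull_min (fun x hx y hy => ?_) (convex_polarDual _)
    rw [Set.mem_singleton_iff.1 hy, dotProduct_comm]
    exact hu x hx
  have := this hv u rfl
  rwa [dotProduct_comm] at this

theorem zero_mem_interior_polarDual {d : ℕ} {W : Set (Fin d → ℝ)} (hW : W.Finite) :
    (0 : Fin d → ℝ) ∈ interior (polarDual W) := by
  rw [mem_interior_iff_mem_nhds]
  have h : ∀ w ∈ W, ∀ᶠ u in nhds (0 : Fin d → ℝ), -1 ≤ u ⬝ᵥ w := by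
    intro w _
    have hc : Continuous fun u : Fin d → ℝ => u ⬝ᵥ w := by unfold dotProduct; fun_prop
    exact (hc.tendsto 0).eventually (Ici_mem_nhds (by simp))
  exact (hW.eventually_all (l := nhds 0)).2 h

theorem isLatticePolytope_convexHull {d : ℕ} {V : Set (Fin d → ℝ)} (hV : V.Finite)
    (hl : V ⊆ lattice d) : IsLatticePolytope (convexHull ℝ V) :=
  ⟨hV.toFinset, by simpa using hl, by simp⟩

/-- Two finite sets of lattice points whose convex hulls are polar dual to each other. -/
structure IsDualPair {d : ℕ} (V W : Set (Fin d → ℝ)) : Prop where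
  finite_left : V.Finite
  finite_right : W.Finite
  left_subset : V ⊆ lattice d
  right_subset : W ⊆ lattice d
  convexHull_left : convexHull ℝ V = polarDual W
  convexHull_right : convexHull ℝ W = polarDual V

theorem IsDualPair.of_subset {d : ℕ} {V W : Set (Fin d → ℝ)} (hV : V.Finite) (hW : W.Finite)
    (hVl : V ⊆ lattice d) (hWl : W ⊆ lattice d) (h : ∀ v ∈ V, ∀ w ∈ W, -1 ≤ v ⬝ᵥ w)
    (h1 : polarDual W ⊆ convexHull ℝ V) (h2 : polarDual V ⊆ convexHull ℝ W) :
    IsDualPair V W where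
  finite_left := hV
  finite_right := hW
  left_subset := hVl
  right_subset := hWl
  convexHull_left :=
    Set.Subset.antisymm (convexHull_min (fun v hv w hw => h v hv w hw) (convex_polarDual _)) h1
  convexHull_right :=
    Set.Subset.antisymm (convexHull_min (fun w hw v hv => by
      rw [dotProduct_comm]; exact h v hv w hw) (convex_polarDual _)) h2

namespace IsDualPair

theorem symm {d : ℕ} {V W : Set (Fin d → ℝ)} (h : IsDualPair V W) : IsDualPair W V :=
  ⟨h.finite_right, h.finite_left, h.right_subset, h.left_subset, h.convexHull_right,
    h.convexHull_left⟩

theorem zero_mem_interior {d : ℕ} {V W : Set (Fin d → ℝ)} (h : IsDualPair V W) :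
    (0 : Fin d → ℝ) ∈ interior (convexHull ℝ V) := by
  rw [h.convexHull_left]
  exact zero_mem_interior_polarDual h.finite_right

theorem isReflexive {d : ℕ} {V W : Set (Fin d → ℝ)} (h : IsDualPair V W) :
    IsReflexive (convexHull ℝ V) := by
  refine ⟨isLatticePolytope_convexHull h.finite_left h.left_subset, h.zero_mem_interior, ?_⟩
  rw [polarDual_convexHull, ← h.convexHull_right]
  exact isLatticePolytope_convexHull h.finite_right h.right_subset

/-- A point of a polygon lying on two edges with independent normals is a vertex. -/
theorem mem_extremePoints {V W : Set (Fin 2 → ℝ)} (h : IsDualPair V W) {v w w' : Fin 2 → ℝ}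
    (hv : v ∈ V) (hw : w ∈ W) (hw' : w' ∈ W) (h1 : v ⬝ᵥ w = -1) (h2 : v ⬝ᵥ w' = -1)
    (h3 : planeDet w w' ≠ 0) : v ∈ (convexHull ℝ V).extremePoints ℝ := by
  refine ⟨subset_convexHull ℝ V hv, ?_⟩
  rintro x hx y hy ⟨s, t, hs, ht, hst, rfl⟩
  rw [h.convexHull_left] at hx hy
  have a1 := hx w hw
  have a2 := hx w' hw'
  have b1 := hy w hw
  have b2 := hy w' hw'
  rw [add_dotProduct, smul_dotProduct, smul_dotProduct, smul_eq_mul, smul_eq_mul] at h1 h2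
  -- A weighted mean, with positive weights, of two numbers at least `-1` equals `-1` only if both
  -- do.
  have c1 : x ⬝ᵥ w = -1 := by nlinarith
  have c2 : x ⬝ᵥ w' = -1 := by nlinarith
  have d1 : y ⬝ᵥ w = -1 := by nlinarith
  have d2 : y ⬝ᵥ w' = -1 := by nlinarith
  have hxy : x = y := by
    simp only [dotProduct, Fin.sum_univ_two] at c1 c2 d1 d2
    simp only [planeDet] at h3
    have e0 : (x 0 - y 0) * (w 0 * w' 1 - w 1 * w' 0) = 0 := by
      linear_combination w' 1 * (c1 - d1) - w 1 * (c2 - d2)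
    have e1 : (x 1 - y 1) * (w 0 * w' 1 - w 1 * w' 0) = 0 := by
      linear_combination w 0 * (c2 - d2) - w' 0 * (c1 - d1)
    ext i
    fin_cases i
    · exact sub_eq_zero.1 ((mul_eq_zero.1 e0).resolve_right h3)
    · exact sub_eq_zero.1 ((mul_eq_zero.1 e1).resolve_right h3)
  rw [← hxy, ← add_smul, hst, one_smul]

/-- Reduces terminality to finite checks: `hV` certifies every point of `V` as a vertex by two
independent edge normals, and `hl` lists the lattice points through the inequalities of the dual
description. -/
theorem isTerminal {V W : Set (Fin 2 → ℝ)} (h : IsDualPair V W)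
    (hV : ∀ v ∈ V, ∃ w ∈ W, ∃ w' ∈ W, v ⬝ᵥ w = -1 ∧ v ⬝ᵥ w' = -1 ∧ planeDet w w' ≠ 0)
    (hl : ∀ m n : ℤ, ![(m : ℝ), n] ∈ polarDual W → ![(m : ℝ), n] ∈ V ∪ {0}) :
    IsTerminal (convexHull ℝ V) := by
  have hlat := isLatticePolytope_convexHull h.finite_left h.left_subset
  refine ⟨hlat, h.zero_mem_interior, Set.Subset.antisymm ?_ ?_⟩
  · rintro x ⟨hx, u, rfl⟩
    have hu : (fun i => (u i : ℝ)) = ![(u 0 : ℝ), u 1] := by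
      ext i; fin_cases i <;> simp
    rw [h.convexHull_left] at hx
    simp only [hu] at hx ⊢
    rcases hl _ _ hx with hm | hm
    · obtain ⟨w, hw, w', hw', h1, h2, h3⟩ := hV _ hm
      exact Or.inl (h.mem_extremePoints hm hw hw' h1 h2 h3)
    · exact Or.inr hm
  · rintro x (hx | rfl)
    · exact ⟨hx.1, hlat.extremePoints_subset hx⟩
    · exact ⟨interior_subset h.zero_mem_interior, 0, by ext i; simp⟩

end IsDualPair

/-! ### The explicit polygons and their duals -/

theorem intVec_mem_lattice (m n : ℤ) : ![(m : ℝ), n] ∈ lattice 2 :=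
  ⟨![m, n], by ext i; fin_cases i <;> simp⟩

/-- The vertices of the Fano polygon of `ℙ²`. -/
def triangleVertices : Set (Fin 2 → ℝ) := {![1, 0], ![0, 1], ![-1, -1]}

/-- The vertices of the Fano polygon of `ℙ¹ × ℙ¹`. -/
def diamondVertices : Set (Fin 2 → ℝ) := {![1, 0], ![0, 1], ![-1, 0], ![0, -1]}

/-- The vertices of the Fano polygon of the del Pezzo surface of degree six. -/
def hexagonVertices : Set (Fin 2 → ℝ) :=
  {![1, 0], ![1, 1], ![0, 1], ![-1, 0], ![-1, -1], ![0, -1]}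

/-- The vertices of the Fano polygon of `ℙ(1,1,2)`. -/
def weightedVertices : Set (Fin 2 → ℝ) := {![1, -1], ![0, 1], ![-1, -1]}

/-- The vertices of the square `[-1, 1]²`, the polar dual of the diamond. -/
def squareVertices : Set (Fin 2 → ℝ) := {![1, 1], ![-1, 1], ![-1, -1], ![1, -1]}

theorem Convex.smul_add_smul_add_smul_mem {E : Type*} [AddCommGroup E] [Module ℝ E] {K : Set E}
    (hK : Convex ℝ K) {p q r : E} (hp : p ∈ K) (hq : q ∈ K) (hr : r ∈ K) {s t u : ℝ}
    (hs : 0 ≤ s) (ht : 0 ≤ t) (hu : 0 ≤ u) (h : s + t + u = 1) :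
    s • p + t • q + u • r ∈ K := by
  have := Convex.smul_add_smul_mem (P := (fun x => x - r) '' K) (x := p - r) (y := q - r)
    (by simpa [sub_eq_add_neg, add_comm] using hK.translate (-r)) ⟨r, hr, sub_self r⟩
    ⟨p, hp, rfl⟩ ⟨q, hq, rfl⟩ hs ht (by linarith)
  obtain ⟨z, hz, hz'⟩ := this
  convert hz using 1
  have hu' : u = 1 - s - t := by linarith
  simp only at hz'
  rw [sub_eq_iff_eq_add.1 hz', hu']
  module

theorem isDualPair_triangle :
    IsDualPair triangleVertices {![-1, -1], ![2, -1], ![-1, 2]} := by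
  refine IsDualPair.of_subset (by simp [triangleVertices]) (by simp) ?_ ?_ ?_ ?_ ?_
  · rintro v (rfl | rfl | rfl)
    · exact_mod_cast intVec_mem_lattice 1 0
    · exact_mod_cast intVec_mem_lattice 0 1
    · exact_mod_cast intVec_mem_lattice (-1) (-1)
  · rintro v (rfl | rfl | rfl)
    · exact_mod_cast intVec_mem_lattice (-1) (-1)
    · exact_mod_cast intVec_mem_lattice 2 (-1)
    · exact_mod_cast intVec_mem_lattice (-1) 2
  · rintro v (rfl | rfl | rfl) w (rfl | rfl | rfl) <;> norm_num [Matrix.vec2_dotProduct]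
  · intro z hz
    have h1 := hz ![-1, -1] (by simp)
    have h2 := hz ![2, -1] (by simp)
    have h3 := hz ![-1, 2] (by simp)
    simp [dotProduct, Fin.sum_univ_two] at h1 h2 h3
    have hsub := subset_convexHull ℝ triangleVertices
    convert Convex.smul_add_smul_add_smul_mem (convex_convexHull ℝ triangleVertices)
      (hsub (show ![1, 0] ∈ triangleVertices by simp [triangleVertices]))
      (hsub (show ![0, 1] ∈ triangleVertices by simp [triangleVertices]))
      (hsub (show ![-1, -1] ∈ triangleVertices by simp [triangleVertices]))
      -- Barycentric coordinates of `z`; nonnegativity of each is one of the three inequalities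
      -- `h1`, `h2`, `h3`.
      (s := z 0 + (1 - z 0 - z 1) / 3) (t := z 1 + (1 - z 0 - z 1) / 3)
      (u := (1 - z 0 - z 1) / 3) (by linarith) (by linarith) (by linarith) (by ring) using 1
    ext i
    fin_cases i <;> simp
  · intro z hz
    have h1 := hz ![1, 0] (by simp [triangleVertices])
    have h2 := hz ![0, 1] (by simp [triangleVertices])
    have h3 := hz ![-1, -1] (by simp [triangleVertices])
    simp [dotProduct, Fin.sum_univ_two] at h1 h2 h3
    set W : Set (Fin 2 → ℝ) := {![-1, -1], ![2, -1], ![-1, 2]} with hW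
    have hsub := subset_convexHull ℝ W
    convert Convex.smul_add_smul_add_smul_mem (convex_convexHull ℝ W)
      (hsub (show ![-1, -1] ∈ W by simp [hW]))
      (hsub (show ![2, -1] ∈ W by simp [hW]))
      (hsub (show ![-1, 2] ∈ W by simp [hW]))
      (s := (1 - z 0 - z 1) / 3) (t := (1 + z 0) / 3)
      (u := (1 + z 1) / 3) (by linarith) (by linarith) (by linarith) (by ring) using 1
    ext i
    fin_cases i <;> simp <;> ring

theorem isDualPair_weighted :
    IsDualPair weightedVertices {![0, 1], ![2, -1], ![-2, -1]} := by
  refine IsDualPair.of_subset (by simp [weightedVertices]) (by simp) ?_ ?_ ?_ ?_ ?_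
  · rintro v (rfl | rfl | rfl)
    · exact_mod_cast intVec_mem_lattice 1 (-1)
    · exact_mod_cast intVec_mem_lattice 0 1
    · exact_mod_cast intVec_mem_lattice (-1) (-1)
  · rintro v (rfl | rfl | rfl)
    · exact_mod_cast intVec_mem_lattice 0 1
    · exact_mod_cast intVec_mem_lattice 2 (-1)
    · exact_mod_cast intVec_mem_lattice (-2) (-1)
  · rintro v (rfl | rfl | rfl) w (rfl | rfl | rfl) <;> norm_num [Matrix.vec2_dotProduct]
  · intro z hz
    have h1 := hz ![0, 1] (by simp)
    have h2 := hz ![2, -1] (by simp)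
    have h3 := hz ![-2, -1] (by simp)
    simp [dotProduct, Fin.sum_univ_two] at h1 h2 h3
    have hsub := subset_convexHull ℝ weightedVertices
    convert Convex.smul_add_smul_add_smul_mem (convex_convexHull ℝ weightedVertices)
      (hsub (show ![1, -1] ∈ weightedVertices by simp [weightedVertices]))
      (hsub (show ![0, 1] ∈ weightedVertices by simp [weightedVertices]))
      (hsub (show ![-1, -1] ∈ weightedVertices by simp [weightedVertices]))
      (s := (1 - z 1 + 2 * z 0) / 4) (t := (1 + z 1) / 2)
      (u := (1 - z 1 - 2 * z 0) / 4) (by linarith) (by linarith) (by linarith) (by ring) using 1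
    ext i
    fin_cases i <;> simp <;> ring
  · intro z hz
    have h1 := hz ![1, -1] (by simp [weightedVertices])
    have h2 := hz ![0, 1] (by simp [weightedVertices])
    have h3 := hz ![-1, -1] (by simp [weightedVertices])
    simp [dotProduct, Fin.sum_univ_two] at h1 h2 h3
    set W : Set (Fin 2 → ℝ) := {![0, 1], ![2, -1], ![-2, -1]} with hW
    have hsub := subset_convexHull ℝ W
    convert Convex.smul_add_smul_add_smul_mem (convex_convexHull ℝ W)
      (hsub (show ![0, 1] ∈ W by simp [hW]))
      (hsub (show ![2, -1] ∈ W by simp [hW]))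
      (hsub (show ![-2, -1] ∈ W by simp [hW]))
      (s := (1 + z 1) / 2) (t := (1 - z 1 + z 0) / 4)
      (u := (1 - z 1 - z 0) / 4) (by linarith) (by linarith) (by linarith) (by ring) using 1
    ext i
    fin_cases i <;> simp <;> ring

theorem zero_mem_of_neg_mem {E : Type*} [AddCommGroup E] [Module ℝ E] {K : Set E}
    (hK : Convex ℝ K) {p : E} (hp : p ∈ K) (hn : -p ∈ K) : (0 : E) ∈ K := by
  convert hK hp hn (a := 1 / 2) (b := 1 / 2) (by norm_num) (by norm_num) (by norm_num) using 1
  module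

theorem isDualPair_diamond : IsDualPair diamondVertices squareVertices := by
  refine IsDualPair.of_subset (by simp [diamondVertices]) (by simp [squareVertices]) ?_ ?_ ?_ ?_ ?_
  · rintro v (rfl | rfl | rfl | rfl)
    · exact_mod_cast intVec_mem_lattice 1 0
    · exact_mod_cast intVec_mem_lattice 0 1
    · exact_mod_cast intVec_mem_lattice (-1) 0
    · exact_mod_cast intVec_mem_lattice 0 (-1)
  · rintro v (rfl | rfl | rfl | rfl)
    · exact_mod_cast intVec_mem_lattice 1 1
    · exact_mod_cast intVec_mem_lattice (-1) 1
    · exact_mod_cast intVec_mem_lattice (-1) (-1)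
    · exact_mod_cast intVec_mem_lattice 1 (-1)
  · rintro v (rfl | rfl | rfl | rfl) w (rfl | rfl | rfl | rfl) <;>
      norm_num [Matrix.vec2_dotProduct]
  · intro z hz
    have h1 := hz ![1, 1] (by simp [squareVertices])
    have h2 := hz ![-1, 1] (by simp [squareVertices])
    have h3 := hz ![-1, -1] (by simp [squareVertices])
    have h4 := hz ![1, -1] (by simp [squareVertices])
    simp [dotProduct, Fin.sum_univ_two] at h1 h2 h3 h4
    have hK := convex_convexHull ℝ diamondVertices
    have hsub := subset_convexHull ℝ diamondVertices
    have v1 := hsub (show ![1, 0] ∈ diamondVertices by simp [diamondVertices])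
    have v2 := hsub (show ![0, 1] ∈ diamondVertices by simp [diamondVertices])
    have v3 := hsub (show ![-1, 0] ∈ diamondVertices by simp [diamondVertices])
    have v4 := hsub (show ![0, -1] ∈ diamondVertices by simp [diamondVertices])
    have h0 := zero_mem_of_neg_mem hK v1 (by simpa using v3)
    obtain ⟨p, hp, hx⟩ : ∃ p ∈ convexHull ℝ diamondVertices, ![z 0, 0] = |z 0| • p := by
      rcases abs_cases (z 0) with ⟨h, _⟩ | ⟨h, _⟩
      · exact ⟨_, v1, by rw [h]; simp⟩
      · exact ⟨_, v3, by rw [h]; simp⟩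
    obtain ⟨q, hq, hy⟩ : ∃ q ∈ convexHull ℝ diamondVertices, ![0, z 1] = |z 1| • q := by
      rcases abs_cases (z 1) with ⟨h, _⟩ | ⟨h, _⟩
      · exact ⟨_, v2, by rw [h]; simp⟩
      · exact ⟨_, v4, by rw [h]; simp⟩
    -- The four inequalities together describe the unit ball of the `ℓ¹` norm.
    have hle : |z 0| + |z 1| ≤ 1 := by
      rcases abs_cases (z 0) with ⟨h, _⟩ | ⟨h, _⟩ <;>
        rcases abs_cases (z 1) with ⟨h', _⟩ | ⟨h', _⟩ <;> linarith
    have := Convex.smul_add_smul_mem hK h0 hp hq (abs_nonneg (z 0)) (abs_nonneg (z 1)) hle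
    rw [← hx, ← hy] at this
    convert this using 1
    ext i
    fin_cases i <;> simp
  · intro z hz
    have h1 := hz ![1, 0] (by simp [diamondVertices])
    have h2 := hz ![0, 1] (by simp [diamondVertices])
    have h3 := hz ![-1, 0] (by simp [diamondVertices])
    have h4 := hz ![0, -1] (by simp [diamondVertices])
    simp [dotProduct, Fin.sum_univ_two] at h1 h2 h3 h4
    have hK := convex_convexHull ℝ squareVertices
    have hsub := subset_convexHull ℝ squareVertices
    have v1 := hsub (show ![1, 1] ∈ squareVertices by simp [squareVertices])
    have v2 := hsub (show ![-1, 1] ∈ squareVertices by simp [squareVertices])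
    have v3 := hsub (show ![-1, -1] ∈ squareVertices by simp [squareVertices])
    have v4 := hsub (show ![1, -1] ∈ squareVertices by simp [squareVertices])
    -- Interpolate horizontally along the top and bottom edges, then vertically between the two
    -- points obtained.
    have e1 := hK v1 v2 (a := (1 + z 0) / 2) (b := (1 - z 0) / 2) (by linarith) (by linarith)
      (by ring)
    have e2 := hK v4 v3 (a := (1 + z 0) / 2) (b := (1 - z 0) / 2) (by linarith) (by linarith)
      (by ring)
    convert hK e1 e2 (a := (1 + z 1) / 2) (b := (1 - z 1) / 2) (by linarith) (by linarith)
      (by ring) using 1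
    ext i
    fin_cases i <;> simp <;> ring

/-- The dual is the hexagon itself after a quarter turn. -/
theorem isDualPair_hexagon :
    IsDualPair hexagonVertices {![1, 0], ![1, -1], ![0, -1], ![-1, 0], ![-1, 1], ![0, 1]} := by
  refine IsDualPair.of_subset (by simp [hexagonVertices]) (by simp) ?_ ?_ ?_ ?_ ?_
  · rintro v (rfl | rfl | rfl | rfl | rfl | rfl)
    · exact_mod_cast intVec_mem_lattice 1 0
    · exact_mod_cast intVec_mem_lattice 1 1
    · exact_mod_cast intVec_mem_lattice 0 1
    · exact_mod_cast intVec_mem_lattice (-1) 0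
    · exact_mod_cast intVec_mem_lattice (-1) (-1)
    · exact_mod_cast intVec_mem_lattice 0 (-1)
  · rintro v (rfl | rfl | rfl | rfl | rfl | rfl)
    · exact_mod_cast intVec_mem_lattice 1 0
    · exact_mod_cast intVec_mem_lattice 1 (-1)
    · exact_mod_cast intVec_mem_lattice 0 (-1)
    · exact_mod_cast intVec_mem_lattice (-1) 0
    · exact_mod_cast intVec_mem_lattice (-1) 1
    · exact_mod_cast intVec_mem_lattice 0 1
  · rintro v (rfl | rfl | rfl | rfl | rfl | rfl) w (rfl | rfl | rfl | rfl | rfl | rfl) <;>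
      norm_num [Matrix.vec2_dotProduct]
  · intro z hz
    have h1 := hz ![1, 0] (by simp)
    have h2 := hz ![1, -1] (by simp)
    have h3 := hz ![0, -1] (by simp)
    have h4 := hz ![-1, 0] (by simp)
    have h5 := hz ![-1, 1] (by simp)
    have h6 := hz ![0, 1] (by simp)
    simp [dotProduct, Fin.sum_univ_two] at h1 h2 h3 h4 h5 h6
    have hK := convex_convexHull ℝ hexagonVertices
    have hsub := subset_convexHull ℝ hexagonVertices
    have v1 := hsub (show ![1, 0] ∈ hexagonVertices by simp [hexagonVertices])
    have v2 := hsub (show ![1, 1] ∈ hexagonVertices by simp [hexagonVertices])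
    have v3 := hsub (show ![0, 1] ∈ hexagonVertices by simp [hexagonVertices])
    have v4 := hsub (show ![-1, 0] ∈ hexagonVertices by simp [hexagonVertices])
    have v5 := hsub (show ![-1, -1] ∈ hexagonVertices by simp [hexagonVertices])
    have v6 := hsub (show ![0, -1] ∈ hexagonVertices by simp [hexagonVertices])
    have h0 := zero_mem_of_neg_mem hK v1 (by simpa using v4)
    -- Case split over the six cones spanned by consecutive vertices. In each cone `z` has
    -- nonnegative coordinates, and their sum is at most 1 by the inequality of the corresponding
    -- edge.
    rcases le_total 0 (z 0) with hx | hx <;> rcases le_total 0 (z 1) with hy | hy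
    · rcases le_total (z 0) (z 1) with hxy | hxy
      · convert Convex.smul_add_smul_mem hK h0 v2 v3 hx (sub_nonneg.2 hxy) (by linarith) using 1
        ext i
        fin_cases i <;> simp
      · convert Convex.smul_add_smul_mem hK h0 v2 v1 hy (sub_nonneg.2 hxy) (by linarith) using 1
        ext i
        fin_cases i <;> simp
    · convert Convex.smul_add_smul_mem hK h0 v1 v6 hx (neg_nonneg.2 hy) (by linarith) using 1
      ext i
      fin_cases i <;> simp
    · convert Convex.smul_add_smul_mem hK h0 v4 v3 (neg_nonneg.2 hx) hy (by linarith) using 1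
      ext i
      fin_cases i <;> simp
    · rcases le_total (z 0) (z 1) with hxy | hxy
      · convert Convex.smul_add_smul_mem hK h0 v5 v4 (neg_nonneg.2 hy) (sub_nonneg.2 hxy)
          (by linarith) using 1
        ext i
        fin_cases i <;> simp
      · convert Convex.smul_add_smul_mem hK h0 v5 v6 (neg_nonneg.2 hx) (sub_nonneg.2 hxy)
          (by linarith) using 1
        ext i
        fin_cases i <;> simp
  · intro z hz
    have h1 := hz ![1, 0] (by simp [hexagonVertices])
    have h2 := hz ![1, 1] (by simp [hexagonVertices])
    have h3 := hz ![0, 1] (by simp [hexagonVertices])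
    have h4 := hz ![-1, 0] (by simp [hexagonVertices])
    have h5 := hz ![-1, -1] (by simp [hexagonVertices])
    have h6 := hz ![0, -1] (by simp [hexagonVertices])
    simp [dotProduct, Fin.sum_univ_two] at h1 h2 h3 h4 h5 h6
    set W : Set (Fin 2 → ℝ) := {![1, 0], ![1, -1], ![0, -1], ![-1, 0], ![-1, 1], ![0, 1]} with hW
    have hK := convex_convexHull ℝ W
    have hsub := subset_convexHull ℝ W
    have v1 := hsub (show ![1, 0] ∈ W by simp [hW])
    have v2 := hsub (show ![1, -1] ∈ W by simp [hW])
    have v3 := hsub (show ![0, -1] ∈ W by simp [hW])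
    have v4 := hsub (show ![-1, 0] ∈ W by simp [hW])
    have v5 := hsub (show ![-1, 1] ∈ W by simp [hW])
    have v6 := hsub (show ![0, 1] ∈ W by simp [hW])
    have h0 := zero_mem_of_neg_mem hK v1 (by simpa using v4)
    rcases le_total 0 (z 0) with hx | hx <;> rcases le_total 0 (z 1) with hy | hy
    · convert Convex.smul_add_smul_mem hK h0 v1 v6 hx hy (by linarith) using 1
      ext i
      fin_cases i <;> simp
    · rcases le_total 0 (z 0 + z 1) with hxy | hxy
      · convert Convex.smul_add_smul_mem hK h0 v2 v1 (neg_nonneg.2 hy) hxy (by linarith) using 1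
        ext i
        fin_cases i <;> simp
      · convert Convex.smul_add_smul_mem hK h0 v2 v3 hx (neg_nonneg.2 hxy) (by linarith) using 1
        ext i
        fin_cases i <;> simp
    · rcases le_total 0 (z 0 + z 1) with hxy | hxy
      · convert Convex.smul_add_smul_mem hK h0 v5 v6 (neg_nonneg.2 hx) hxy (by linarith) using 1
        ext i
        fin_cases i <;> simp
      · convert Convex.smul_add_smul_mem hK h0 v5 v4 hy (neg_nonneg.2 hxy) (by linarith) using 1
        ext i
        fin_cases i <;> simp
    · convert Convex.smul_add_smul_mem hK h0 v4 v3 (neg_nonneg.2 hx) (neg_nonneg.2 hy)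
        (by linarith) using 1
      ext i
      fin_cases i <;> simp

theorem isTerminal_triangle : IsTerminal (convexHull ℝ triangleVertices) := by
  refine isDualPair_triangle.isTerminal ?_ ?_
  · rintro v (rfl | rfl | rfl)
    · refine ⟨![-1, -1], by simp, ![-1, 2], by simp, ?_, ?_, ?_⟩ <;>
        norm_num [dotProduct, Fin.sum_univ_two, planeDet]
    · refine ⟨![-1, -1], by simp, ![2, -1], by simp, ?_, ?_, ?_⟩ <;>
        norm_num [dotProduct, Fin.sum_univ_two, planeDet]
    · refine ⟨![-1, 2], by simp, ![2, -1], by simp, ?_, ?_, ?_⟩ <;>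
        norm_num [dotProduct, Fin.sum_univ_two, planeDet]
  · intro m n hz
    have h1 := hz ![-1, -1] (by simp)
    have h2 := hz ![2, -1] (by simp)
    have h3 := hz ![-1, 2] (by simp)
    simp [dotProduct, Fin.sum_univ_two] at h1 h2 h3
    norm_cast at h1 h2 h3
    -- The inequalities confine the point to a 3 × 3 box; each of its nine lattice points either
    -- violates one of them or is listed.
    have a1 : -1 ≤ m := by omega
    have a2 : m ≤ 1 := by omega
    have a3 : -1 ≤ n := by omega
    have a4 : n ≤ 1 := by omega
    interval_cases m <;> interval_cases n <;> first | omega | simp [triangleVertices]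

theorem isTerminal_diamond : IsTerminal (convexHull ℝ diamondVertices) := by
  refine isDualPair_diamond.isTerminal ?_ ?_
  · rintro v (rfl | rfl | rfl | rfl)
    · refine ⟨![-1, -1], by simp [squareVertices], ![-1, 1], by simp [squareVertices], ?_, ?_, ?_⟩
        <;> norm_num [dotProduct, Fin.sum_univ_two, planeDet]
    · refine ⟨![-1, -1], by simp [squareVertices], ![1, -1], by simp [squareVertices], ?_, ?_, ?_⟩
        <;> norm_num [dotProduct, Fin.sum_univ_two, planeDet]
    · refine ⟨![1, 1], by simp [squareVertices], ![1, -1], by simp [squareVertices], ?_, ?_, ?_⟩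
        <;> norm_num [dotProduct, Fin.sum_univ_two, planeDet]
    · refine ⟨![1, 1], by simp [squareVertices], ![-1, 1], by simp [squareVertices], ?_, ?_, ?_⟩
        <;> norm_num [dotProduct, Fin.sum_univ_two, planeDet]
  · intro m n hz
    have h1 := hz ![1, 1] (by simp [squareVertices])
    have h2 := hz ![-1, 1] (by simp [squareVertices])
    have h3 := hz ![-1, -1] (by simp [squareVertices])
    have h4 := hz ![1, -1] (by simp [squareVertices])
    simp [dotProduct, Fin.sum_univ_two] at h1 h2 h3 h4
    norm_cast at h1 h2 h3 h4
    have a1 : -1 ≤ m := by omega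
    have a2 : m ≤ 1 := by omega
    have a3 : -1 ≤ n := by omega
    have a4 : n ≤ 1 := by omega
    interval_cases m <;> interval_cases n <;> first | omega | simp [diamondVertices]

theorem isTerminal_hexagon : IsTerminal (convexHull ℝ hexagonVertices) := by
  refine isDualPair_hexagon.isTerminal ?_ ?_
  · rintro v (rfl | rfl | rfl | rfl | rfl | rfl)
    · refine ⟨![-1, 0], by simp, ![-1, 1], by simp, ?_, ?_, ?_⟩ <;>
        norm_num [dotProduct, Fin.sum_univ_two, planeDet]
    · refine ⟨![-1, 0], by simp, ![0, -1], by simp, ?_, ?_, ?_⟩ <;>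
        norm_num [dotProduct, Fin.sum_univ_two, planeDet]
    · refine ⟨![0, -1], by simp, ![1, -1], by simp, ?_, ?_, ?_⟩ <;>
        norm_num [dotProduct, Fin.sum_univ_two, planeDet]
    · refine ⟨![1, 0], by simp, ![1, -1], by simp, ?_, ?_, ?_⟩ <;>
        norm_num [dotProduct, Fin.sum_univ_two, planeDet]
    · refine ⟨![1, 0], by simp, ![0, 1], by simp, ?_, ?_, ?_⟩ <;>
        norm_num [dotProduct, Fin.sum_univ_two, planeDet]
    · refine ⟨![0, 1], by simp, ![-1, 1], by simp, ?_, ?_, ?_⟩ <;>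
        norm_num [dotProduct, Fin.sum_univ_two, planeDet]
  · intro m n hz
    have h1 := hz ![1, 0] (by simp)
    have h2 := hz ![1, -1] (by simp)
    have h3 := hz ![0, -1] (by simp)
    have h4 := hz ![-1, 0] (by simp)
    have h5 := hz ![-1, 1] (by simp)
    have h6 := hz ![0, 1] (by simp)
    simp [dotProduct, Fin.sum_univ_two] at h1 h2 h3 h4 h5 h6
    norm_cast at h1 h2 h3 h4 h5 h6
    have a1 : -1 ≤ m := by omega
    have a2 : m ≤ 1 := by omega
    have a3 : -1 ≤ n := by omega
    have a4 : n ≤ 1 := by omega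
    interval_cases m <;> interval_cases n <;> first | omega | simp [hexagonVertices]


/-! ### The action of `SL(2, ℤ)` -/

open Matrix MatrixGroups

/-- The action of a matrix in `SL(2, ℤ)` on the plane. -/
noncomputable def slMap (g : SL(2, ℤ)) : (Fin 2 → ℝ) →ₗ[ℝ] (Fin 2 → ℝ) :=
  (g.1.map (Int.cast : ℤ → ℝ)).mulVecLin

theorem slMap_apply (g : SL(2, ℤ)) (v : Fin 2 → ℝ) :
    slMap g v = ![g 0 0 * v 0 + g 0 1 * v 1, g 1 0 * v 0 + g 1 1 * v 1] := by
  ext i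
  fin_cases i <;> simp [slMap, mulVec, dotProduct, Fin.sum_univ_two]

theorem slMap_mul (g h : SL(2, ℤ)) (v : Fin 2 → ℝ) : slMap (g * h) v = slMap g (slMap h v) := by
  simp only [slMap, mulVecLin_apply, mulVec_mulVec]
  congr 1
  exact Matrix.map_mul (f := Int.castRingHom ℝ)

theorem slMap_one (v : Fin 2 → ℝ) : slMap 1 v = v := by
  rw [slMap_apply]
  ext i
  fin_cases i <;> simp

theorem slMap_mem_lattice (g : SL(2, ℤ)) {v : Fin 2 → ℝ} (hv : v ∈ lattice 2) :
    slMap g v ∈ lattice 2 := by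
  obtain ⟨w, rfl⟩ := hv
  rw [slMap_apply]
  beta_reduce
  exact_mod_cast intVec_mem_lattice (g 0 0 * w 0 + g 0 1 * w 1) (g 1 0 * w 0 + g 1 1 * w 1)

theorem slMap_injective (g : SL(2, ℤ)) : Function.Injective (slMap g) := by
  intro x y h
  rw [← slMap_one x, ← slMap_one y, ← inv_mul_cancel g, slMap_mul, slMap_mul, h]

theorem slMap_mem_lattice_iff (g : SL(2, ℤ)) {v : Fin 2 → ℝ} :
    slMap g v ∈ lattice 2 ↔ v ∈ lattice 2 := by
  refine ⟨fun h => ?_, slMap_mem_lattice g⟩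
  have := slMap_mem_lattice g⁻¹ h
  rwa [← slMap_mul, inv_mul_cancel, slMap_one] at this

theorem mem_slMap_image_iff {g : SL(2, ℤ)} {P : Set (Fin 2 → ℝ)} {v : Fin 2 → ℝ} :
    v ∈ slMap g '' P ↔ slMap g⁻¹ v ∈ P := by
  constructor
  · rintro ⟨w, hw, rfl⟩
    rwa [← slMap_mul, inv_mul_cancel, slMap_one]
  · intro h
    exact ⟨_, h, by rw [← slMap_mul, mul_inv_cancel, slMap_one]⟩

theorem slMap_image_mul (g h : SL(2, ℤ)) (P : Set (Fin 2 → ℝ)) :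
    slMap (g * h) '' P = slMap g '' (slMap h '' P) := by
  rw [Set.image_image]
  exact Set.image_congr fun v _ => slMap_mul g h v

theorem slMap_image_one (P : Set (Fin 2 → ℝ)) : slMap 1 '' P = P := by
  simp [slMap_one]

theorem isLatticePolytope_slMap_image (g : SL(2, ℤ)) {P : Set (Fin 2 → ℝ)}
    (h : IsLatticePolytope P) : IsLatticePolytope (slMap g '' P) := by
  obtain ⟨S, hS, rfl⟩ := h
  rw [LinearMap.image_convexHull]
  refine isLatticePolytope_convexHull (S.finite_toSet.image _) ?_
  rintro _ ⟨v, hv, rfl⟩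
  exact slMap_mem_lattice g (hS hv)

theorem zero_mem_interior_slMap_image (g : SL(2, ℤ)) {P : Set (Fin 2 → ℝ)}
    (h : (0 : Fin 2 → ℝ) ∈ interior P) : (0 : Fin 2 → ℝ) ∈ interior (slMap g '' P) := by
  rw [mem_interior_iff_mem_nhds] at h ⊢
  have hc : Continuous (slMap g⁻¹) := LinearMap.continuous_of_finiteDimensional _
  have := hc.tendsto 0
  rw [map_zero] at this
  filter_upwards [this h] with v hv
  exact mem_slMap_image_iff.2 hv

theorem dotProduct_slMap (g : SL(2, ℤ)) (u v : Fin 2 → ℝ) :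
    u ⬝ᵥ slMap g v = slMap g.transpose u ⬝ᵥ v := by
  simp only [slMap_apply, dotProduct, Fin.sum_univ_two, SpecialLinearGroup.coe_transpose,
    transpose_apply, cons_val_zero, cons_val_one]
  ring

/-- The adjoint of `slMap g` for the dot product is `slMap g.transpose`, so the dual moves by the
inverse transpose, which is again in `SL(2, ℤ)`. -/
theorem polarDual_slMap_image (g : SL(2, ℤ)) (P : Set (Fin 2 → ℝ)) :
    polarDual (slMap g '' P) = slMap g.transpose⁻¹ '' polarDual P := by
  ext u
  rw [mem_slMap_image_iff, inv_inv]
  constructor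
  · intro h v hv
    rw [← dotProduct_slMap]
    exact h _ ⟨v, hv, rfl⟩
  · rintro h _ ⟨v, hv, rfl⟩
    rw [dotProduct_slMap]
    exact h v hv

theorem IsReflexive.slMap_image (g : SL(2, ℤ)) {P : Set (Fin 2 → ℝ)} (h : IsReflexive P) :
    IsReflexive (slMap g '' P) :=
  ⟨isLatticePolytope_slMap_image g h.1, zero_mem_interior_slMap_image g h.2.1, by
    rw [polarDual_slMap_image]; exact isLatticePolytope_slMap_image _ h.2.2⟩

theorem IsTerminal.slMap_image (g : SL(2, ℤ)) {P : Set (Fin 2 → ℝ)} (h : IsTerminal P) :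
    IsTerminal (slMap g '' P) := by
  refine ⟨isLatticePolytope_slMap_image g h.1, zero_mem_interior_slMap_image g h.2.1, ?_⟩
  have hext : (slMap g '' P).extremePoints ℝ = slMap g '' P.extremePoints ℝ := by
    let e : (Fin 2 → ℝ) ≃ₗ[ℝ] (Fin 2 → ℝ) := LinearEquiv.ofLinearMap (slMap g) (slMap g⁻¹)
      (LinearMap.ext fun v => by simp [← slMap_mul, slMap_one])
      (LinearMap.ext fun v => by simp [← slMap_mul, slMap_one])
    exact (image_extremePoints e P).symm
  have hlat : slMap g '' lattice 2 = lattice 2 := by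
    ext v
    rw [mem_slMap_image_iff, slMap_mem_lattice_iff]
  calc slMap g '' P ∩ lattice 2 = slMap g '' P ∩ slMap g '' lattice 2 := by rw [hlat]
    _ = (slMap g '' P).extremePoints ℝ ∪ {0} := by
      rw [← Set.image_inter (slMap_injective g), h.2.2, Set.image_union, Set.image_singleton,
        map_zero, hext]

/-! ### Reflexive and terminal polytopes are canonical -/

/-- If `t • x ∈ P` with `t > 1`, each lattice point `u` spanning the dual has `u ⬝ᵥ x ≥ -1 / t >
-1`, hence `u ⬝ᵥ x ≥ 0` by integrality. The whole dual then lies in a half-space, yet it contains a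
small negative multiple of `x` because `P` is bounded. -/
theorem IsReflexive.isCanonical {d : ℕ} {P : Set (Fin d → ℝ)} (h : IsReflexive P) :
    IsCanonical P where
  isLatticePolytope := h.1
  zero_mem_interior := h.2.1
  smul_notMem := by
    intro x hx hx0 t ht hm
    obtain ⟨S, hS, hSP⟩ := h.2.2
    have hpos : ∀ u ∈ polarDual P, 0 ≤ u ⬝ᵥ x := by
      have hS' : (S : Set (Fin d → ℝ)) ⊆ {u | 0 ≤ u ⬝ᵥ x} := by
        intro u hu
        have h1 : u ∈ polarDual P := hSP ▸ subset_convexHull ℝ _ hu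
        have h2 := h1 _ hm
        obtain ⟨a, rfl⟩ := hS hu
        obtain ⟨b, rfl⟩ := hx
        have h3 : ((fun i => (a i : ℝ)) ⬝ᵥ fun i => (b i : ℝ)) = ((∑ i, a i * b i : ℤ) : ℝ) := by
          simp [dotProduct]
        rw [dotProduct_smul, smul_eq_mul] at h2
        change 0 ≤ (fun i => (a i : ℝ)) ⬝ᵥ fun i => (b i : ℝ)
        rw [h3] at h2 ⊢
        by_contra! hneg
        have h4 : ((∑ i, a i * b i : ℤ) : ℝ) ≤ -1 := by
          have : (∑ i, a i * b i : ℤ) < 0 := by exact_mod_cast hneg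
          exact_mod_cast (by omega : (∑ i, a i * b i : ℤ) ≤ -1)
        nlinarith
      rw [hSP]
      refine convexHull_min hS' ?_
      intro u hu v hv s t hs ht _
      have hu : 0 ≤ u ⬝ᵥ x := hu
      have hv : 0 ≤ v ⬝ᵥ x := hv
      change 0 ≤ (s • u + t • v) ⬝ᵥ x
      rw [add_dotProduct, smul_dotProduct, smul_dotProduct, smul_eq_mul, smul_eq_mul]
      positivity
    obtain ⟨C, hC⟩ := h.1.isCompact.exists_bound_of_continuousOn (f := fun v => x ⬝ᵥ v)
      (by unfold dotProduct; fun_prop)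
    have hC0 : 0 ≤ C := (norm_nonneg _).trans (hC 0 (interior_subset h.2.1))
    -- `C` bounds `|x ⬝ᵥ v|` on `P`; `C + 1` keeps the denominator positive when `C = 0`.
    have hmem : (-(1 / (C + 1))) • x ∈ polarDual P := by
      intro v hv
      have h1 := (Real.norm_eq_abs _ ▸ hC v hv)
      have h2 := (abs_le.1 h1).2
      rw [smul_dotProduct, smul_eq_mul, neg_mul, neg_le_neg_iff, one_div, inv_mul_le_iff₀
        (by linarith)]
      linarith
    have h1 := hpos _ hmem
    rw [smul_dotProduct, smul_eq_mul] at h1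
    have h2 : 0 < x ⬝ᵥ x := by
      refine lt_of_le_of_ne (Finset.sum_nonneg fun i _ => mul_self_nonneg _) fun h0 => hx0 ?_
      exact dotProduct_self_eq_zero.1 h0.symm
    have h3 : 0 < 1 / (C + 1) := by positivity
    nlinarith [mul_pos h3 h2]

theorem IsTerminal.mem_extremePoints {d : ℕ} {P : Set (Fin d → ℝ)} (h : IsTerminal P)
    {x : Fin d → ℝ} (hx : x ∈ lattice d) (hx0 : x ≠ 0) (hP : x ∈ P) :
    x ∈ P.extremePoints ℝ := by
  have : x ∈ P.extremePoints ℝ ∪ {0} := h.2.2 ▸ ⟨hP, hx⟩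
  exact this.resolve_right hx0

/-- If `t • x ∈ P` with `t > 1`, then `x` lies in `P` strictly between `0` and `t • x`, so it cannot
be a vertex. -/
theorem IsTerminal.isCanonical {d : ℕ} {P : Set (Fin d → ℝ)} (h : IsTerminal P) :
    IsCanonical P where
  isLatticePolytope := h.1
  zero_mem_interior := h.2.1
  smul_notMem := by
    intro x hx hx0 t ht hm
    have h0 : (0 : Fin d → ℝ) ∈ P := interior_subset h.2.1
    have ht0 : 0 < t := by linarith
    have hxP : x ∈ P := by
      have := h.1.convex.smul_mem_of_zero_mem h0 hm (t := t⁻¹)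
        ⟨by positivity, inv_le_one_of_one_le₀ ht.le⟩
      rwa [smul_smul, inv_mul_cancel₀ ht0.ne', one_smul] at this
    have hext := (h.mem_extremePoints hx hx0 hxP).2 h0 hm ⟨1 - t⁻¹, t⁻¹,
      sub_pos.2 (inv_lt_one_of_one_lt₀ ht), by positivity, by ring, by
        rw [smul_zero, zero_add, smul_smul, inv_mul_cancel₀ ht0.ne', one_smul]⟩
    exact hx0 hext.symm

/-! ### Minimal polygons as images of the models -/

theorem exists_slMap_eq {a b : Fin 2 → ℝ} (ha : a ∈ lattice 2) (hb : b ∈ lattice 2)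
    (h : planeDet a b = 1) : ∃ g : SL(2, ℤ), ∀ v, slMap g v = v 0 • a + v 1 • b := by
  obtain ⟨x, rfl⟩ := ha
  obtain ⟨y, rfl⟩ := hb
  have hdet : x 0 * y 1 - x 1 * y 0 = 1 := by
    simp only [planeDet] at h
    exact_mod_cast h
  let g : SL(2, ℤ) := ⟨!![x 0, y 0; x 1, y 1], by rw [det_fin_two_of]; linarith⟩
  refine ⟨g, fun v => (slMap_apply g v).trans ?_⟩
  have h00 : g 0 0 = x 0 := rfl
  have h01 : g 0 1 = y 0 := rfl
  have h10 : g 1 0 = x 1 := rfl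
  have h11 : g 1 1 = y 1 := rfl
  rw [h00, h01, h10, h11]
  ext i
  fin_cases i <;> simp <;> ring

/-- Only determinant 1 is available in `SL(2, ℤ)`, so determinant `-1` is first corrected by an
orientation-reversing symmetry of each model: exchanging `a` and `b` for the first two, `a` and `-a
- 2b` for the third. -/
theorem exists_slMap_image_subset {P : Set (Fin 2 → ℝ)} (hP : Convex ℝ P)
    (h : ContainsMinimal P) : ∃ g : SL(2, ℤ),
      slMap g '' convexHull ℝ triangleVertices ⊆ P ∨ slMap g '' convexHull ℝ diamondVertices ⊆ P ∨
      slMap g '' convexHull ℝ weightedVertices ⊆ P := by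
  obtain ⟨a, ha, b, hb, hal, hbl, hab, h⟩ := h
  rcases h with h | ⟨h, h'⟩ | h
  · wlog hab' : planeDet a b = 1 generalizing a b
    · exact this b hb a ha hbl hal (hab.symm.imp (by rw [planeDet_comm a b]; intro h; linarith)
        (by rw [planeDet_comm a b]; intro h; linarith)) (by convert h using 1; abel)
        (by rw [planeDet_comm a b]; linarith [hab.resolve_left hab'])
    obtain ⟨g, hg⟩ := exists_slMap_eq hal hbl hab'
    refine ⟨g, Or.inl ?_⟩
    rw [LinearMap.image_convexHull]
    refine convexHull_min ?_ hP
    rintro _ ⟨v, rfl | rfl | rfl, rfl⟩ <;> rw [hg]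
    · simpa using ha
    · simpa using hb
    · simpa [sub_eq_add_neg] using h
  · wlog hab' : planeDet a b = 1 generalizing a b
    · exact this b hb a ha hbl hal (hab.symm.imp (by rw [planeDet_comm a b]; intro h; linarith)
        (by rw [planeDet_comm a b]; intro h; linarith)) h' h
        (by rw [planeDet_comm a b]; linarith [hab.resolve_left hab'])
    obtain ⟨g, hg⟩ := exists_slMap_eq hal hbl hab'
    refine ⟨g, Or.inr (Or.inl ?_)⟩
    rw [LinearMap.image_convexHull]
    refine convexHull_min ?_ hP
    rintro _ ⟨v, rfl | rfl | rfl | rfl, rfl⟩ <;> rw [hg]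
    · simpa using ha
    · simpa using hb
    · simpa using h
    · simpa using h'
  · have hcl : -a - (2 : ℝ) • b ∈ lattice 2 := by
      rw [sub_eq_add_neg]
      exact add_mem_lattice (neg_mem_lattice hal)
        (neg_mem_lattice (by exact_mod_cast zsmul_mem_lattice 2 hbl))
    have hdet : planeDet (-a - (2 : ℝ) • b) b = -planeDet a b := by
      simp only [planeDet, Pi.sub_apply, Pi.neg_apply, Pi.smul_apply, smul_eq_mul]; ring
    wlog hab' : planeDet a b = 1 generalizing a
    · have hval := hab.resolve_left hab'
      refine this _ h hcl (Or.inl (by rw [hdet, hval]; norm_num)) ?_ ?_ ?_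
        (by rw [hdet, hval]; norm_num)
      · convert ha using 1; module
      · convert hal using 1; module
      · rw [show -(-a - (2 : ℝ) • b) - (2 : ℝ) • b = a by module, hdet, neg_neg]
    -- The basis `a + b`, `b` sends the model vertices `(1, -1)`, `(0, 1)`, `(-1, -1)` to `a`, `b`,
    -- `-a - 2b`.
    obtain ⟨g, hg⟩ := exists_slMap_eq (add_mem_lattice hal hbl) hbl
      (by rw [planeDet_comm, planeDet_add_right, planeDet_self, planeDet_comm a b, hab']; ring)
    refine ⟨g, Or.inr (Or.inr ?_)⟩
    rw [LinearMap.image_convexHull]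
    refine convexHull_min ?_ hP
    rintro _ ⟨v, rfl | rfl | rfl, rfl⟩ <;> rw [hg]
    · convert ha using 1; simp
    · simpa using hb
    · convert h using 1; simp; module

/-! ### Connectedness of the web -/

/-- Two sets lie in the same connected component of the inclusion web of `C`. -/
def WebJoined {d : ℕ} (C : Set (Fin d → ℝ) → Prop) (P Q : Set (Fin d → ℝ)) : Prop :=
  ∃ (hP : C P) (hQ : C Q), (inclusionWeb C).Reachable ⟨P, hP⟩ ⟨Q, hQ⟩

namespace WebJoined

variable {d : ℕ} {C : Set (Fin d → ℝ) → Prop} {P Q R : Set (Fin d → ℝ)}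

theorem symm (h : WebJoined C P Q) : WebJoined C Q P :=
  ⟨h.2.1, h.1, h.2.2.symm⟩

theorem trans (h : WebJoined C P Q) (h' : WebJoined C Q R) : WebJoined C P R :=
  ⟨h.1, h'.2.1, h.2.2.trans h'.2.2⟩

theorem of_subset (hP : C P) (hQ : C Q) (h : P ⊆ Q) : WebJoined C P Q := by
  refine ⟨hP, hQ, ?_⟩
  by_cases hPQ : P = Q
  · subst hPQ
    exact SimpleGraph.Reachable.refl _
  · refine SimpleGraph.Adj.reachable ?_
    rw [inclusionWeb, SimpleGraph.fromRel_adj]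
    exact ⟨fun h => hPQ (congrArg Subtype.val h), Or.inl h⟩

/-- Linear images preserve inclusions, so `SL(2, ℤ)` acts on the web of an invariant class and
carries paths to paths. -/
theorem slMap_image {C : Set (Fin 2 → ℝ) → Prop} {P Q : Set (Fin 2 → ℝ)}
    (hC : ∀ (g : SL(2, ℤ)) (P), C P → C (slMap g '' P)) (g : SL(2, ℤ)) (h : WebJoined C P Q) :
    WebJoined C (slMap g '' P) (slMap g '' Q) := by
  obtain ⟨hP, hQ, h⟩ := h
  refine ⟨hC g P hP, hC g Q hQ, ?_⟩
  rw [SimpleGraph.reachable_iff_reflTransGen] at h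
  suffices ∀ R : {P // C P}, Relation.ReflTransGen (inclusionWeb C).Adj ⟨P, hP⟩ R →
      (inclusionWeb C).Reachable ⟨_, hC g P hP⟩ ⟨_, hC g R.1 R.2⟩ from this _ h
  intro R hR
  induction hR with
  | refl => exact SimpleGraph.Reachable.refl _
  | tail _ hadj ih =>
    refine ih.trans ?_
    rw [inclusionWeb, SimpleGraph.fromRel_adj] at hadj
    rcases hadj.2 with hs | hs
    · exact (of_subset (hC g _ (Subtype.prop _)) (hC g _ (Subtype.prop _)) (Set.image_mono hs)).2.2
    · exact (of_subset (hC g _ (Subtype.prop _)) (hC g _ (Subtype.prop _))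
        (Set.image_mono hs)).2.2.symm

end WebJoined

theorem diamond_subset_hexagon :
    convexHull ℝ diamondVertices ⊆ convexHull ℝ hexagonVertices := by
  refine convexHull_mono ?_
  rintro v (rfl | rfl | rfl | rfl) <;> simp [hexagonVertices]

theorem triangle_subset_hexagon :
    convexHull ℝ triangleVertices ⊆ convexHull ℝ hexagonVertices := by
  refine convexHull_mono ?_
  rintro v (rfl | rfl | rfl) <;> simp [hexagonVertices]

theorem slMap_S_diamond_subset :
    slMap ModularGroup.S '' convexHull ℝ diamondVertices ⊆ convexHull ℝ hexagonVertices := by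
  rw [LinearMap.image_convexHull]
  refine convexHull_mono ?_
  rintro _ ⟨v, rfl | rfl | rfl | rfl, rfl⟩ <;>
    simp [slMap_apply, ModularGroup.coe_S, hexagonVertices]

theorem slMap_T_diamond_subset :
    slMap ModularGroup.T '' convexHull ℝ diamondVertices ⊆ convexHull ℝ hexagonVertices := by
  rw [LinearMap.image_convexHull]
  refine convexHull_mono ?_
  rintro _ ⟨v, rfl | rfl | rfl | rfl, rfl⟩ <;>
    simp [slMap_apply, ModularGroup.coe_T, hexagonVertices]

/-- All unimodular copies of the hexagon lie in one component: `S` and `T` generate `SL(2, ℤ)`, and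
each of them moves the diamond inside the hexagon. -/
theorem webJoined_hexagon {C : Set (Fin 2 → ℝ) → Prop}
    (hC : ∀ (g : SL(2, ℤ)) (P), C P → C (slMap g '' P)) (hhex : C (convexHull ℝ hexagonVertices))
    (hdia : C (convexHull ℝ diamondVertices)) (g : SL(2, ℤ)) :
    WebJoined C (convexHull ℝ hexagonVertices) (slMap g '' convexHull ℝ hexagonVertices) := by
  have hg : g ∈ Subgroup.closure {ModularGroup.S, ModularGroup.T} := by
    rw [SpecialLinearGroup.SL2Z_generators]; trivial
  induction hg using Subgroup.closure_induction with
  | mem x hx =>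
    have hsub : slMap x '' convexHull ℝ diamondVertices ⊆ convexHull ℝ hexagonVertices := by
      rcases hx with rfl | rfl
      · exact slMap_S_diamond_subset
      · exact slMap_T_diamond_subset
    -- The image of the diamond under `x` lies both in the hexagon and in the image of the hexagon.
    exact (WebJoined.of_subset (hC x _ hdia) hhex hsub).symm.trans
      (WebJoined.of_subset (hC x _ hdia) (hC x _ hhex) (Set.image_mono diamond_subset_hexagon))
  | one =>
    rw [slMap_image_one]
    exact WebJoined.of_subset hhex hhex subset_rfl
  -- The path for `y`, translated by `x`, continues the path for `x`.
  | mul x y _ _ hx hy =>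
    rw [slMap_image_mul]
    exact hx.trans (hy.slMap_image hC x)
  | inv x _ hx =>
    have := hx.slMap_image hC x⁻¹
    rw [← slMap_image_mul, inv_mul_cancel, slMap_image_one] at this
    exact this.symm

/-- The argument common to both classes; `hw` isolates the `ℙ(1,1,2)` case, the only one in which
they need different treatment. -/
theorem inclusionWeb_connected {C : Set (Fin 2 → ℝ) → Prop}
    (hC : ∀ (g : SL(2, ℤ)) (P), C P → C (slMap g '' P)) (hhex : C (convexHull ℝ hexagonVertices))
    (hdia : C (convexHull ℝ diamondVertices)) (htri : C (convexHull ℝ triangleVertices))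
    (hcan : ∀ P, C P → IsCanonical P)
    (hw : ∀ P, C P → ∀ g : SL(2, ℤ), slMap g '' convexHull ℝ weightedVertices ⊆ P →
      WebJoined C (slMap g '' convexHull ℝ diamondVertices) P) :
    (inclusionWeb C).Connected := by
  have key : ∀ P, C P → WebJoined C (convexHull ℝ hexagonVertices) P := by
    intro P hP
    obtain ⟨g, h⟩ := exists_slMap_image_subset (hcan P hP).isLatticePolytope.convex
      (hcan P hP).containsMinimal
    have hhg := webJoined_hexagon hC hhex hdia g
    have hdg := hhg.trans (WebJoined.of_subset (hC g _ hdia) (hC g _ hhex)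
      (Set.image_mono diamond_subset_hexagon)).symm
    rcases h with h | h | h
    · exact (hhg.trans (WebJoined.of_subset (hC g _ htri) (hC g _ hhex)
        (Set.image_mono triangle_subset_hexagon)).symm).trans
        (WebJoined.of_subset (hC g _ htri) hP h)
    · exact hdg.trans (WebJoined.of_subset (hC g _ hdia) hP h)
    · exact hdg.trans (hw P hP g h)
  rw [SimpleGraph.connected_iff_exists_forall_reachable]
  exact ⟨⟨_, hhex⟩, fun P => (key P.1 P.2).2.2⟩

theorem diamond_subset_square :
    convexHull ℝ diamondVertices ⊆ convexHull ℝ squareVertices := by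
  rw [isDualPair_diamond.convexHull_right]
  refine convexHull_min ?_ (convex_polarDual _)
  rintro v (rfl | rfl | rfl | rfl) w (rfl | rfl | rfl | rfl) <;>
    norm_num [Matrix.vec2_dotProduct]

theorem weighted_subset_square :
    convexHull ℝ weightedVertices ⊆ convexHull ℝ squareVertices := by
  rw [isDualPair_diamond.convexHull_right]
  refine convexHull_min ?_ (convex_polarDual _)
  rintro v (rfl | rfl | rfl) w (rfl | rfl | rfl | rfl) <;>
    norm_num [Matrix.vec2_dotProduct]

/-- The square, reflexive as the dual of the diamond, contains both the diamond and the triangle of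
`ℙ(1,1,2)` and so bridges them. -/
theorem inclusionWeb_isReflexive_connected :
    (inclusionWeb (IsReflexive (d := 2))).Connected := by
  refine inclusionWeb_connected (fun g P h => h.slMap_image g) isDualPair_hexagon.isReflexive
    isDualPair_diamond.isReflexive isDualPair_triangle.isReflexive (fun P h => h.isCanonical) ?_
  intro P hP g hg
  have hsq := isDualPair_diamond.symm.isReflexive.slMap_image g
  have hwt := isDualPair_weighted.isReflexive.slMap_image g
  exact ((WebJoined.of_subset (isDualPair_diamond.isReflexive.slMap_image g) hsq
    (Set.image_mono diamond_subset_square)).trans (WebJoined.of_subset hwt hsq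
    (Set.image_mono weighted_subset_square)).symm).trans (WebJoined.of_subset hwt hP hg)

/-- A terminal polygon contains no copy of the polygon of `ℙ(1,1,2)`, one of whose edges has a
lattice point in its relative interior. -/
theorem IsTerminal.not_weighted_subset {P : Set (Fin 2 → ℝ)} (hP : IsTerminal P) (g : SL(2, ℤ)) :
    ¬ slMap g '' convexHull ℝ weightedVertices ⊆ P := by
  intro hg
  have hsub := subset_convexHull ℝ weightedVertices
  have h1 : ![1, -1] ∈ convexHull ℝ weightedVertices := hsub (by simp [weightedVertices])
  have h2 : ![-1, -1] ∈ convexHull ℝ weightedVertices := hsub (by simp [weightedVertices])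
  have hmid : (1 / 2 : ℝ) • ![(1 : ℝ), -1] + (1 / 2 : ℝ) • ![-1, -1] = ![0, -1] := by
    ext i
    fin_cases i <;> norm_num
  have h3 : ![0, -1] ∈ convexHull ℝ weightedVertices := by
    rw [← hmid]
    exact convex_convexHull ℝ _ h1 h2 (by norm_num) (by norm_num) (by norm_num)
  have hl : ![(0 : ℝ), -1] ∈ lattice 2 := by exact_mod_cast intVec_mem_lattice 0 (-1)
  have hne : slMap g ![0, -1] ≠ 0 := by
    rw [← map_zero (slMap g)]
    intro h
    simpa using congrFun (slMap_injective g h) 1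
  have hext := hP.mem_extremePoints (slMap_mem_lattice g hl) hne (hg ⟨_, h3, rfl⟩)
  have heq := hext.2 (hg ⟨_, h1, rfl⟩) (hg ⟨_, h2, rfl⟩) ⟨1 / 2, 1 / 2, by norm_num, by norm_num,
    by norm_num, by rw [← map_smul, ← map_smul, ← map_add, hmid]⟩
  simpa using congrFun (slMap_injective g heq) 0

/-- The square is not terminal and gives no bridge here, but none is needed: the `ℙ(1,1,2)` case is
vacuous. -/
theorem inclusionWeb_isTerminal_connected :
    (inclusionWeb (IsTerminal (d := 2))).Connected :=
  inclusionWeb_connected (fun g _ h => h.slMap_image g) isTerminal_hexagon isTerminal_diamond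
    isTerminal_triangle (fun _ h => h.isCanonical)
    fun _ hP g hg => absurd hg (hP.not_weighted_subset g)

end LatticeWeb

theorem theorem1p1 :
    (LatticeWeb.inclusionWeb (LatticeWeb.IsReflexive (d := 2))).Connected ∧
      (LatticeWeb.inclusionWeb (LatticeWeb.IsTerminal (d := 2))).Connected :=
  ⟨LatticeWeb.inclusionWeb_isReflexive_connected, LatticeWeb.inclusionWeb_isTerminal_connected⟩
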